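/- Let $G=(V,E)$ be a simple biconnected (connected, and still connected after the removal of any one vertex) planar cubic graph with $|V|=2n$ that is not bipartite, embedded in the plane. A *Heawood vector* is a map $\sigma:V\to\mathbb F_3\setminus\{0\}$ with $\sum_{v\in f}\sigma(v)=0$ for every face $f$ (including the external one), the sum being over the vertices of $f$. A set $S\subseteq V$ is *defining* if any two Heawood vectors that agree on $S$ are equal; a defining set $S$ is *minimal* if $S\setminus\{v\}$ is not defining for any $v\in S$. The *main system* is the homogeneous linear system over $\mathbb F_3$ in the variables $\sigma(v)$, $v\in V$, that consists of the equations $\sum_{v\in f}\sigma(v)=0$ for all internal faces $f$. A set $S\subseteq V$ is a *set of (indices of) free variables* if the remaining variables can be taken as the basic ones, i.e. the columns of the matrix of the system indexed by $V\setminus S$ form a basis of its column space. For a cycle $C$ of $G$ let $V_{in}(C)$ be the set of vertices of the faces inside $C$, without $V(C)$. Let $C_0$ be a cycle and let $C_1,\dots,C_k$ ($k\ge 0$) be pairwise disjoint cycles with $V(C_i)\subseteq V_{in}(C_0)$. Let $W\subseteq\bigcup_{i=0}^kV(C_i)$ have an even number of vertices on each $C_i$, $0\le i\le k$, and let $|W|=2m$.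 Let $P_1,\dots,P_m$ be pairwise disjoint paths in $G$, each with two distinct endpoints in $W$, such that $V(P_j)\subseteq \bigl(V_{in}(C_0)\setminus\bigcup_{i=1}^kV(C_i)\bigr)\cup W$, and whose edges are not edges of the cycles and lie between $C_0$ and $C_1,\dots,C_k$ (the faces on both sides of each such edge are inside $C_0$ and not inside any $C_i$, $i\ge 1$). Then the set $\bigl(\bigcup_{i=0}^kV(C_i)\cup\bigcup_{j=1}^mV(P_j)\bigr)\setminus W$ is called a *zebra*. The following holds. 1. Sets of free variables of the main system exist, and every such set $S$ has $n-1$ elements and is a defining set. 2. If $S$ is a set of free variables, then for any values in $\mathbb F_3$ of the variables in $S$ there is exactly one solution of the main system with these values, and if all its components are nonzero, then it is a Heawood vector. 3. If a set of vertices contains a zebra, then it is not a minimal defining set. 4. No set of exactly $n$ vertices is a minimal defining set. -/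

import Mathlib

/-- A graph is biconnected if it is connected and stays connected after the removal of any
single vertex. -/
def Biconnected {V : Type*} (G : SimpleGraph V) : Prop :=
  G.Connected ∧ ∀ v : V, (G.induce {v}ᶜ).Connected

/-- An embedding of a finite connected simple graph in the sphere, up to homeomorphism, given by
the cyclic order of the darts (directed edges) around every vertex.  The faces are the orbits of
`d ↦ rot d.symm`, and `euler` is Euler's formula `|V| + |F| = |E| + 2`, which says that the closed
surface obtained by gluing a disc along every face is the sphere. -/
structure PlanarEmbedding {V : Type*} (G : SimpleGraph V) where
  /-- the next dart around the origin of a dart -/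
  rot : Equiv.Perm G.Dart
  rot_fst : ∀ d : G.Dart, (rot d).fst = d.fst
  rot_cyclic : ∀ d d' : G.Dart, d.fst = d'.fst → rot.SameCycle d d'
  euler : Nat.card V +
      Nat.card (Quotient (Equiv.Perm.SameCycle.setoid
        (rot * SimpleGraph.Dart.symm_involutive.toPerm))) = Nat.card G.edgeSet + 2

namespace PlanarEmbedding

variable {V : Type*} {G : SimpleGraph V} (M : PlanarEmbedding G)

/-- The permutation that takes a dart to the next dart along the boundary of the same face. -/
def facePerm : Equiv.Perm G.Dart :=
  M.rot * SimpleGraph.Dart.symm_involutive.toPerm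

/-- The faces of the embedding. -/
def Face : Type _ := Quotient (Equiv.Perm.SameCycle.setoid M.facePerm)

/-- The face on a fixed side of the dart `d`; the face on the other side of the same edge is
`M.face d.symm`. -/
def face (d : G.Dart) : M.Face := Quotient.mk (Equiv.Perm.SameCycle.setoid M.facePerm) d

/-- The set of vertices of a face. -/
def faceVerts (f : M.Face) : Set V := {v | ∃ d : G.Dart, d.fst = v ∧ M.face d = f}

/-! ### Heawood vectors and defining sets -/

open Classical in
/-- The spins `σ` are proper for the face `f`: they sum to zero over its vertices. -/
def IsProper [Fintype V] (σ : V → ZMod 3) (f : M.Face) : Prop :=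
  ∑ v with v ∈ M.faceVerts f, σ v = 0

/-- A Heawood vector: nonzero spins that are proper for all faces. -/
def IsHeawood [Fintype V] (σ : V → ZMod 3) : Prop :=
  (∀ v, σ v ≠ 0) ∧ ∀ f : M.Face, M.IsProper σ f

/-- A set of vertices is defining if the spins of a Heawood vector at these vertices determine
all its spins. -/
def IsDefining [Fintype V] (S : Set V) : Prop :=
  ∀ σ τ : V → ZMod 3, M.IsHeawood σ → M.IsHeawood τ → (∀ v ∈ S, σ v = τ v) → σ = τ

/-- A defining set is minimal if the deletion of any of its vertices makes it non-defining. -/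
def IsMinimalDefining [Fintype V] (S : Set V) : Prop :=
  M.IsDefining S ∧ ∀ v ∈ S, ¬ M.IsDefining (S \ {v})

/-! ### The main system.  The face `o` is the external one, all other faces are internal. -/

open Classical in
/-- The matrix of the main system: one equation for each internal face, one variable for each
vertex. -/
noncomputable def mainMatrix (o : M.Face) : Matrix {f : M.Face // f ≠ o} V (ZMod 3) :=
  Matrix.of fun f v => if v ∈ M.faceVerts f.1 then 1 else 0

/-- `σ` is a solution of the main system (zero values are allowed). -/
def IsMainSolution [Fintype V] (o : M.Face) (σ : V → ZMod 3) : Prop :=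
  (M.mainMatrix o).mulVec σ = 0

/-- `S` is a set of indices of free variables of the main system: the remaining variables are a
possible choice of basic (pivot) variables, that is, their columns form a basis of the column
space of the matrix. -/
def IsFreeSet (o : M.Face) (S : Set V) : Prop :=
  LinearIndepOn (ZMod 3) (M.mainMatrix o).col Sᶜ ∧
    Submodule.span (ZMod 3) ((M.mainMatrix o).col '' Sᶜ) =
      Submodule.span (ZMod 3) (Set.range (M.mainMatrix o).col)

/-! ### Zebras -/

/-- The face `f` lies in the internal domain of the cycle `c`: it cannot be reached from the
external face `o` by crossing only edges that are not on `c`. -/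
def IsInside (o : M.Face) {u : V} (c : G.Walk u u) (f : M.Face) : Prop :=
  ¬ Relation.ReflTransGen
    (fun g h : M.Face => ∃ d : G.Dart, d.edge ∉ c.edges ∧ M.face d = g ∧ M.face d.symm = h) o f

/-- The vertices of the faces in the internal domain of `c`, without the vertices of `c`. -/
def innerVerts (o : M.Face) {u : V} (c : G.Walk u u) : Set V :=
  {v | (∃ f : M.Face, M.IsInside o c f ∧ v ∈ M.faceVerts f) ∧ v ∉ c.support}

/-- The cycles `C₀, …, C_k`, the chosen vertices `W` and the paths `P₁, …, P_m` of a zebra. -/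
structure ZebraData (o : M.Face) where
  k : ℕ
  base : Fin (k + 1) → V
  /-- the cycles `C₀, …, C_k` -/
  cycle : ∀ i, G.Walk (base i) (base i)
  isCycle : ∀ i, (cycle i).IsCycle
  cycle_inner : ∀ i, i ≠ 0 → ∀ v ∈ (cycle i).support, v ∈ M.innerVerts o (cycle 0)
  cycle_disjoint : ∀ i j, i ≠ j → ∀ v ∈ (cycle i).support, v ∉ (cycle j).support
  /-- the chosen vertices: evenly many on every cycle, `2m` in total -/
  W : Set V
  W_subset : ∀ w ∈ W, ∃ i, w ∈ (cycle i).support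
  W_even : ∀ i, Even (W ∩ {v | v ∈ (cycle i).support}).ncard
  m : ℕ
  W_card : W.ncard = 2 * m
  src : Fin m → V
  tgt : Fin m → V
  src_mem : ∀ j, src j ∈ W
  tgt_mem : ∀ j, tgt j ∈ W
  src_ne_tgt : ∀ j, src j ≠ tgt j
  /-- the paths `P₁, …, P_m` -/
  path : ∀ j, G.Walk (src j) (tgt j)
  isPath : ∀ j, (path j).IsPath
  path_disjoint : ∀ i j, i ≠ j → ∀ v ∈ (path i).support, v ∉ (path j).support
  path_inner : ∀ j, ∀ v ∈ (path j).support, v ∉ W →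
    v ∈ M.innerVerts o (cycle 0) ∧ ∀ i, v ∉ (cycle i).support
  /-- the paths use no edges of the cycles -/
  path_edges : ∀ j, ∀ e ∈ (path j).edges, ∀ i, e ∉ (cycle i).edges
  /-- the paths run between `C₀` and `C₁, …, C_k`: both faces at each of their edges are inside
  `C₀` and outside `C₁, …, C_k` -/
  path_between : ∀ j, ∀ d : G.Dart, d.edge ∈ (path j).edges →
    M.IsInside o (cycle 0) (M.face d) ∧ ∀ i, i ≠ 0 → ¬ M.IsInside o (cycle i) (M.face d)

/-- The vertices of the cycles and of the paths, without the chosen vertices. -/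
def ZebraData.verts {M : PlanarEmbedding G} {o : M.Face} (Z : M.ZebraData o) : Set V :=
  {v | ((∃ i, v ∈ (Z.cycle i).support) ∨ ∃ j, v ∈ (Z.path j).support) ∧ v ∉ Z.W}

/-- A set of vertices is a zebra. -/
def IsZebra (o : M.Face) (A : Set V) : Prop := ∃ Z : M.ZebraData o, Z.verts = A

end PlanarEmbedding

/-! Giving each face a weight in $\mathbb F_3$ and adding the face equations yields the relation
$\sum_v a_v\sigma(v)=0$, where $a_v$ is the sum of the weights of the three faces at $v$. All
weights 1 give $a=0$, so the external equation follows from the internal ones. Conversely, $a=0$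
forces constant weights: around each vertex the weights then increase by a fixed step, the step
changes sign along every edge, and a nonzero step would 2-colour the vertices
(`eq_of_sum_darts_eq_zero`). Euler's formula gives $n+2$ faces, so the main system has rank $n+1$
and its solution space has dimension $n-1$. This settles claims 1 and 2.

A nontrivial relation supported on $S$ expresses one spin in $S$ through the others, so $S$ cannot
be minimal (`not_isMinimalDefining_of_relation`). For $|S|=n$ the relation exists by dimension. For
a zebra, the paths cut the region between the cycles into pieces coloured alternately $1$ and $-1$,
and other faces get weight 0. The resulting $a$ is supported on the zebra (`exists_weights`) and is
nonzero because the weights are not constant.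

The topology (faces on the two sides of an edge differ, a cycle separates, the alternate colouring
exists) comes from `exists_coboundary_eq`: every mod 2 cycle bounds a set of faces. -/

/-! ### Incidence matrices modulo two -/

open Classical in
/-- The number modulo two of elements with prescribed images under two maps. -/
noncomputable def fiberMatrix {D I J : Type*} [Fintype D] (p : D → I) (q : D → J) :
    Matrix I J (ZMod 2) :=
  Matrix.of fun i j => ∑ d, if p d = i ∧ q d = j then 1 else 0

section FiberMatrix

variable {D I J : Type*} [Fintype D]

open Classical in
theorem fiberMatrix_mulVec [Fintype J] (p : D → I) (q : D → J) (x : J → ZMod 2) (i : I) :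
    (fiberMatrix p q).mulVec x i = ∑ d with p d = i, x (q d) := by
  simp only [fiberMatrix, Matrix.mulVec, dotProduct, Matrix.of_apply, Finset.sum_mul]
  rw [Finset.sum_comm, Finset.sum_filter]
  refine Finset.sum_congr rfl fun d _ => ?_
  by_cases h : p d = i <;> simp [h]

open Classical in
theorem fiberMatrix_transpose (p : D → I) (q : D → J) :
    (fiberMatrix p q).transpose = fiberMatrix q p := by
  ext i j
  simp only [fiberMatrix, Matrix.transpose_apply, Matrix.of_apply]
  exact Finset.sum_congr rfl fun d _ => if_congr and_comm rfl rfl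

/-- A matrix over a field whose kernel consists of the constant vectors has corank one. -/
theorem Matrix.rank_add_one_of_ker_eq_const {K : Type*} [Field K] [Fintype J] [Nonempty J]
    (A : Matrix I J K) (hA : ∀ x, A.mulVec x = 0 ↔ ∃ a, x = fun _ => a) :
    A.rank + 1 = Fintype.card J := by
  have h := LinearMap.finrank_range_add_finrank_ker A.mulVecLin
  have hk : LinearMap.ker A.mulVecLin = Submodule.span K {(fun _ => 1 : J → K)} := by
    ext x
    rw [LinearMap.mem_ker, Matrix.mulVecLin_apply, hA, Submodule.mem_span_singleton]
    constructor
    · rintro ⟨a, rfl⟩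
      exact ⟨a, by ext; simp⟩
    · rintro ⟨a, rfl⟩
      exact ⟨a, by ext; simp⟩
  rw [hk, finrank_span_singleton (fun h => one_ne_zero (congrFun h (Classical.arbitrary J))),
    Module.finrank_pi] at h
  exact h

end FiberMatrix

/-! ### Chains of edges modulo two and their boundaries -/

namespace SimpleGraph

variable {V : Type*} {G : SimpleGraph V}

/-- The edge of a dart, as an element of the edge set. -/
def Dart.toEdge (d : G.Dart) : G.edgeSet := ⟨d.edge, d.edge_mem⟩

@[simp] theorem Dart.toEdge_symm (d : G.Dart) : d.symm.toEdge = d.toEdge := by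
  simp [Dart.toEdge]

theorem exists_toEdge_eq (e : G.edgeSet) : ∃ d : G.Dart, d.toEdge = e := by
  obtain ⟨e, he⟩ := e
  induction e using Sym2.ind with
  | _ v w => exact ⟨⟨(v, w), he⟩, rfl⟩

theorem Dart.toEdge_eq_iff (d d' : G.Dart) : d.toEdge = d'.toEdge ↔ d = d' ∨ d = d'.symm := by
  rw [← dart_edge_eq_iff, Dart.toEdge, Dart.toEdge, Subtype.mk.injEq]

open Classical in
/-- The edges of a walk, as a chain modulo two. -/
noncomputable def Walk.chain {u v : V} (p : G.Walk u v) : G.edgeSet → ZMod 2 :=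
  fun e => (p.edges.count e.1 : ZMod 2)

theorem Walk.chain_of_notMem {u v : V} {p : G.Walk u v} {e : G.edgeSet} (h : e.1 ∉ p.edges) :
    p.chain e = 0 := by
  classical
  simp [Walk.chain, List.count_eq_zero_of_not_mem h]

theorem Walk.chain_of_mem {u v : V} {p : G.Walk u v} (hp : p.edges.Nodup) {e : G.edgeSet}
    (h : e.1 ∈ p.edges) : p.chain e = 1 := by
  classical
  simp [Walk.chain, List.count_eq_one_of_mem hp h]

section Chains

variable [Fintype G.Dart]

theorem fiberMatrix_toEdge_mulVec {J : Type*} [Fintype J] (q : G.Dart → J) (x : J → ZMod 2)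
    (d : G.Dart) :
    (fiberMatrix Dart.toEdge q).mulVec x d.toEdge = x (q d) + x (q d.symm) := by
  classical
  rw [fiberMatrix_mulVec]
  have : (Finset.univ.filter fun d' : G.Dart => d'.toEdge = d.toEdge) = {d, d.symm} := by
    ext d'
    simp [Dart.toEdge_eq_iff]
  rw [← Finset.sum_pair (f := fun d => x (q d)) d.symm_ne.symm]
  exact Finset.sum_congr (by rw [← this]; congr) fun _ _ => rfl

theorem fiberMatrix_toEdge_mulVec_eq_zero_iff {J : Type*} [Fintype J] (q : G.Dart → J)
    (x : J → ZMod 2) :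
    (fiberMatrix Dart.toEdge q).mulVec x = 0 ↔ ∀ d, x (q d) = x (q d.symm) := by
  constructor
  · intro h d
    have := congrFun h d.toEdge
    rw [fiberMatrix_toEdge_mulVec] at this
    exact CharTwo.add_eq_zero.mp this
  · intro h
    ext e
    obtain ⟨d, rfl⟩ := exists_toEdge_eq e
    rw [fiberMatrix_toEdge_mulVec, h d, CharTwo.add_self_eq_zero]
    rfl

variable [Fintype G.edgeSet]

/-- The boundary of a chain of edges modulo two. -/
noncomputable def chainBoundary (y : G.edgeSet → ZMod 2) : V → ZMod 2 :=
  (fiberMatrix (fun d : G.Dart => d.fst) Dart.toEdge).mulVec y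

open Classical in
theorem chainBoundary_apply (y : G.edgeSet → ZMod 2) (v : V) :
    chainBoundary y v = ∑ d : G.Dart with d.fst = v, y d.toEdge := by
  rw [chainBoundary, fiberMatrix_mulVec]

theorem chainBoundary_add (y z : G.edgeSet → ZMod 2) :
    chainBoundary (y + z) = chainBoundary y + chainBoundary z := Matrix.mulVec_add _ _ _

theorem chainBoundary_zero : chainBoundary (0 : G.edgeSet → ZMod 2) = 0 := Matrix.mulVec_zero _

theorem chainBoundary_sum {ι : Type*} (s : Finset ι) (y : ι → G.edgeSet → ZMod 2) :
    chainBoundary (∑ i ∈ s, y i) = ∑ i ∈ s, chainBoundary (y i) :=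
  map_sum (fiberMatrix (fun d : G.Dart => d.fst) Dart.toEdge).mulVecLin y s

open Classical in
theorem chainBoundary_single (d : G.Dart) :
    chainBoundary (Pi.single d.toEdge 1) = Pi.single d.fst 1 + Pi.single d.snd 1 := by
  ext v
  have : ∀ d' : G.Dart, (Pi.single d.toEdge 1 : G.edgeSet → ZMod 2) d'.toEdge =
      (if d' = d then 1 else 0) + if d' = d.symm then 1 else 0 := by
    intro d'
    by_cases h1 : d' = d
    · subst h1
      simp [d'.symm_ne.symm]
    · by_cases h2 : d' = d.symm
      · subst h2
        simp [d.symm_ne]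
      · have : d'.toEdge ≠ d.toEdge := by rw [Ne, Dart.toEdge_eq_iff]; tauto
        simp [this, h1, h2]
  rw [chainBoundary_apply, Finset.sum_congr rfl fun d' _ => this d', Finset.sum_add_distrib]
  simp [Finset.sum_ite_eq', Pi.single_apply, eq_comm]

open Classical in
theorem chainBoundary_chain {u v : V} (p : G.Walk u v) :
    chainBoundary p.chain = Pi.single u 1 + Pi.single v 1 := by
  induction p with
  | nil =>
    rw [show (Walk.nil : G.Walk _ _).chain = 0 by ext e; simp [Walk.chain], chainBoundary_zero]
    exact (funext fun w => CharTwo.add_self_eq_zero ((Pi.single _ 1 : V → ZMod 2) w)).symm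
  | @cons u v w h p ih =>
    have : (Walk.cons h p).chain = Pi.single (Dart.mk (u, v) h).toEdge 1 + p.chain := by
      ext e
      simp only [Walk.chain, Walk.edges_cons, List.count_cons, Pi.add_apply, Nat.cast_add]
      rw [add_comm]
      congr 1
      rw [Pi.single_apply]
      by_cases he : e = (Dart.mk (u, v) h).toEdge
      · subst he
        simp [Dart.toEdge, Dart.edge]
      · have : ¬ s(u, v) = e.1 := fun h' => he (Subtype.ext h'.symm)
        simp [he, this]
    have hv : (Pi.single v 1 + Pi.single v 1 : V → ZMod 2) = 0 :=
      funext fun _ => CharTwo.add_self_eq_zero _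
    rw [this, chainBoundary_add, ih, chainBoundary_single, add_assoc, ← add_assoc (Pi.single v 1),
      hv, zero_add]

end Chains

end SimpleGraph

open SimpleGraph

/-! ### Faces, coboundaries and exactness on the sphere -/

namespace PlanarEmbedding

variable {V : Type*} {G : SimpleGraph V} (M : PlanarEmbedding G)

instance [Finite G.Dart] : Finite M.Face :=
  inferInstanceAs (Finite (Quotient (Equiv.Perm.SameCycle.setoid M.facePerm)))

noncomputable instance [Finite G.Dart] : Fintype M.Face := Fintype.ofFinite _

theorem exists_face_eq (f : M.Face) : ∃ d : G.Dart, M.face d = f := Quotient.exists_rep f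

/-- `facePerm` sends `d.symm` to `rot d`, so turning at a vertex amounts to crossing an edge. -/
theorem face_rot (d : G.Dart) : M.face (M.rot d) = M.face d.symm := by
  have h : M.facePerm d.symm = M.rot d := by
    simp [facePerm, Function.Involutive.toPerm]
  rw [← h]
  exact Quotient.sound ((Equiv.Perm.sameCycle_apply_left).mpr (Equiv.Perm.SameCycle.refl _ _))

theorem apply_eq_of_fst_eq {α : Type*} {g : G.Dart → α} (hrot : ∀ d, g (M.rot d) = g d)
    {d d' : G.Dart} (h : d.fst = d'.fst) : g d = g d' := by
  obtain ⟨i, hi⟩ := M.rot_cyclic d d' h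
  have key : ∀ (n : ℕ) (d : G.Dart), g ((M.rot ^ n) d) = g d := by
    intro n
    induction n with
    | zero => simp
    | succ n ih => intro d; rw [pow_succ', Equiv.Perm.mul_apply, hrot, ih]
  subst hi
  obtain ⟨n, rfl | rfl⟩ := i.eq_nat_or_neg
  · rw [zpow_natCast, key]
  · rw [← key n ((M.rot ^ (-(n : ℤ))) d), ← Equiv.Perm.mul_apply, zpow_neg, zpow_natCast,
      mul_inv_cancel, Equiv.Perm.one_apply]

/-- The rotation and the reversal of darts act transitively on the darts of a connected graph. -/
theorem apply_eq_of_connected {α : Type*} (hG : G.Connected) {g : G.Dart → α}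
    (hrot : ∀ d, g (M.rot d) = g d) (hsymm : ∀ d, g d.symm = g d) (d d' : G.Dart) :
    g d = g d' := by
  obtain ⟨p⟩ := hG.preconnected d.fst d'.fst
  have : ∀ {u v : V} (p : G.Walk u v) (d d' : G.Dart), d.fst = u → d'.fst = v → g d = g d' := by
    intro u v p
    induction p with
    | nil => intro d d' h h'; exact M.apply_eq_of_fst_eq hrot (h.trans h'.symm)
    | @cons u v w h p ih =>
      intro d d' hd hd'
      rw [← ih (Dart.mk (u, v) h).symm d' rfl hd', hsymm]
      exact M.apply_eq_of_fst_eq hrot hd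
  exact this p d d' rfl rfl

theorem apply_face_eq_of_connected {α : Type*} (hG : G.Connected) {c : M.Face → α}
    (hc : ∀ d, c (M.face d) = c (M.face d.symm)) (f f' : M.Face) : c f = c f' := by
  obtain ⟨d, rfl⟩ := M.exists_face_eq f
  obtain ⟨d', rfl⟩ := M.exists_face_eq f'
  exact M.apply_eq_of_connected hG (g := fun d => c (M.face d))
    (fun d => by rw [face_rot, hc, Dart.symm_symm]) (fun d => (hc d).symm) d d'

section Exactness

variable [Fintype G.Dart]

/-- The edges that separate faces with different values of `x`, as a chain modulo two. -/
noncomputable def coboundary (x : M.Face → ZMod 2) : G.edgeSet → ZMod 2 :=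
  (fiberMatrix Dart.toEdge M.face).mulVec x

theorem coboundary_toEdge (x : M.Face → ZMod 2) (d : G.Dart) :
    M.coboundary x d.toEdge = x (M.face d) + x (M.face d.symm) :=
  fiberMatrix_toEdge_mulVec _ _ _

variable [Fintype G.edgeSet]

/-- By `face_rot` each face at a vertex is counted twice, once from either neighbouring edge. -/
theorem chainBoundary_coboundary (x : M.Face → ZMod 2) :
    chainBoundary (M.coboundary x) = 0 := by
  classical
  ext v
  simp only [chainBoundary_apply, coboundary_toEdge, ← face_rot, Finset.sum_add_distrib]
  have : ∑ d : G.Dart with d.fst = v, x (M.face (M.rot d)) =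
      ∑ d : G.Dart with d.fst = v, x (M.face d) := by
    refine Finset.sum_equiv M.rot (fun d => ?_) fun _ _ => rfl
    simp [M.rot_fst]
  rw [this, CharTwo.add_self_eq_zero]
  rfl

/-- A graph drawn on the sphere has no first homology modulo two. -/
theorem exists_coboundary_eq [Fintype V] [Nonempty G.Dart] (hG : G.Connected)
    {y : G.edgeSet → ZMod 2} (hy : chainBoundary y = 0) : ∃ x, M.coboundary x = y := by
  have hV : Nonempty V := hG.nonempty
  have hF : Nonempty M.Face := ⟨M.face (Classical.arbitrary _)⟩
  set A := fiberMatrix (Dart.toEdge (G := G)) M.face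
  set N := fiberMatrix (fun d : G.Dart => d.fst) Dart.toEdge
  have hA : A.rank + 1 = Fintype.card M.Face := by
    refine A.rank_add_one_of_ker_eq_const fun x => ?_
    rw [fiberMatrix_toEdge_mulVec_eq_zero_iff]
    constructor
    · intro h
      exact ⟨x hF.some, funext fun f => M.apply_face_eq_of_connected hG h _ _⟩
    · rintro ⟨a, rfl⟩ d
      rfl
  have hN : N.rank + 1 = Fintype.card V := by
    -- The transpose compares the values at the two ends of each edge, so its kernel is constant by
    -- connectedness.
    rw [← Matrix.rank_transpose]
    refine Matrix.rank_add_one_of_ker_eq_const _ fun x => ?_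
    rw [fiberMatrix_transpose, fiberMatrix_toEdge_mulVec_eq_zero_iff]
    constructor
    · intro h
      obtain ⟨w⟩ := hV
      refine ⟨x w, funext fun v => ?_⟩
      obtain ⟨p⟩ := hG.preconnected v w
      induction p with
      | nil => rfl
      | @cons u v w h' p ih => rw [← ih]; exact h ⟨(u, v), h'⟩
    · rintro ⟨a, rfl⟩ d
      rfl
  have hle : LinearMap.range A.mulVecLin ≤ LinearMap.ker N.mulVecLin := by
    rintro _ ⟨x, rfl⟩
    exact M.chainBoundary_coboundary x
  have hdim := LinearMap.finrank_range_add_finrank_ker N.mulVecLin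
  rw [Module.finrank_pi] at hdim
  have heuler : Fintype.card V + Fintype.card M.Face = Fintype.card G.edgeSet + 2 := by
    have := M.euler
    rw [Nat.card_eq_fintype_card (α := V), Nat.card_eq_fintype_card (α := G.edgeSet)] at this
    rw [← this, ← Nat.card_eq_fintype_card (α := M.Face)]
    rfl
  -- The image has dimension $|F|-1$ and the kernel $|E|-|V|+1$; these agree by Euler's formula.
  have heq := Submodule.eq_of_le_of_finrank_eq hle (by
    change A.rank = _
    change N.rank + _ = _ at hdim
    omega)
  have : y ∈ LinearMap.range A.mulVecLin := by
    rw [heq]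
    exact hy
  exact this

end Exactness

end PlanarEmbedding

/-! ### Local structure of a biconnected cubic plane graph -/

namespace SimpleGraph

variable {V : Type*} {G : SimpleGraph V}

theorem IsRegularOfDegree.ncard_darts [Fintype V] [DecidableRel G.Adj] {k : ℕ}
    (hG : G.IsRegularOfDegree k) (v : V) : {d : G.Dart | d.fst = v}.ncard = k := by
  classical
  rw [← hG v, ← G.dart_fst_fiber_card_eq_degree v, ← Set.ncard_coe_finset]
  congr 1
  ext d
  simp

/-- In a biconnected cubic graph the endpoints of an edge are joined by a walk that avoids it. -/
theorem exists_walk_notMem_edges [Finite G.Dart] (hcub : ∀ v, {d : G.Dart | d.fst = v}.ncard = 3)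
    (hG : Biconnected G) (d : G.Dart) : ∃ p : G.Walk d.snd d.fst, d.edge ∉ p.edges := by
  obtain ⟨e, he, hed⟩ : ∃ e ∈ {e : G.Dart | e.fst = d.fst}, e ≠ d :=
    Set.exists_ne_of_one_lt_ncard (by rw [hcub]; norm_num) d
  have hsnd : e.snd ≠ d.snd := fun h => hed (Dart.ext _ _ (Prod.ext he h))
  have he' : e.fst = d.fst := he
  -- Reach another neighbour of `d.fst` without visiting `d.fst`, then return along the edge of `e`.
  obtain ⟨p⟩ := (hG.2 d.fst).preconnected ⟨d.snd, d.adj.ne'⟩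
    ⟨e.snd, by rw [Set.mem_compl_singleton_iff, ← he']; exact e.adj.ne'⟩
  let q : G.Walk d.snd e.snd := p.map (Embedding.induce _).toHom
  have hq : d.fst ∉ q.support := by
    intro h
    obtain ⟨⟨x, hx⟩, -, h⟩ := List.mem_map.mp (Walk.support_map _ p ▸ h)
    exact hx h
  refine ⟨q.concat (v := e.snd) (w := d.fst) (he' ▸ e.adj.symm), ?_⟩
  rw [Walk.edges_concat, List.concat_eq_append, List.mem_append, List.mem_singleton]
  rintro (h | h)
  · exact hq (Walk.fst_mem_support_of_mem_edges _ h)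
  · rw [Dart.edge] at h
    have := Sym2.eq_iff.mp h
    rcases this with ⟨h1, h2⟩ | ⟨h1, h2⟩
    · exact d.adj.ne h2.symm
    · exact hsnd h2.symm

end SimpleGraph

namespace PlanarEmbedding

variable {V : Type*} {G : SimpleGraph V} (M : PlanarEmbedding G)

section Cubic

variable (hcub : ∀ v, {d : G.Dart | d.fst = v}.ncard = 3)

include hcub

theorem rot_ne (d : G.Dart) : M.rot d ≠ d := by
  intro h
  obtain ⟨e, he, hed⟩ : ∃ e ∈ {e : G.Dart | e.fst = d.fst}, e ≠ d :=
    Set.exists_ne_of_one_lt_ncard (by rw [hcub]; norm_num) d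
  exact hed ((M.rot_cyclic d e he.symm).eq_of_left h).symm

theorem exists_fst_eq (v : V) : ∃ d : G.Dart, d.fst = v :=
  Set.nonempty_of_ncard_ne_zero (s := {d : G.Dart | d.fst = v}) (by rw [hcub]; norm_num)

variable [Fintype G.Dart]

/-- Otherwise the rotation orbit of `d`, which contains all three darts at its origin, would have at
most two elements. -/
theorem rot_rot_ne (d : G.Dart) : M.rot (M.rot d) ≠ d := by
  intro h
  have hsub : {e : G.Dart | e.fst = d.fst} ⊆ {d, M.rot d} := by
    intro e he
    obtain ⟨n, -, rfl⟩ := (M.rot_cyclic d e he.symm).exists_pow_eq'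
    clear he
    induction n with
    | zero => simp
    | succ n ih =>
      rw [pow_succ', Equiv.Perm.mul_apply]
      rcases ih with ih | ih
      · rw [ih]; simp
      · rw [Set.mem_singleton_iff.mp ih, h]; simp
  have := Set.ncard_le_ncard hsub
  rw [hcub, Set.ncard_pair (M.rot_ne hcub d).symm] at this
  omega

theorem darts_eq (d : G.Dart) :
    {e : G.Dart | e.fst = d.fst} = {d, M.rot d, M.rot (M.rot d)} := by
  symm
  refine Set.eq_of_subset_of_ncard_le ?_ ?_
  · rintro e (rfl | rfl | rfl) <;> simp [M.rot_fst]
  · rw [hcub, Set.ncard_insert_of_notMem, Set.ncard_pair (M.rot_ne hcub _).symm]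
    rintro (h | h)
    · exact M.rot_ne hcub d h.symm
    · exact M.rot_rot_ne hcub d h.symm

theorem eq_or_eq_rot {d e : G.Dart} (h : e.fst = d.fst) :
    e = d ∨ e = M.rot d ∨ e = M.rot (M.rot d) := by
  have : e ∈ {e : G.Dart | e.fst = d.fst} := h
  rwa [M.darts_eq hcub] at this

theorem rot_rot_rot (d : G.Dart) : M.rot (M.rot (M.rot d)) = d := by
  have h : (M.rot (M.rot (M.rot d))).fst = d.fst := by simp [M.rot_fst]
  rcases M.eq_or_eq_rot hcub h with h | h | h
  · exact h
  · exact absurd (M.rot.injective h) (M.rot_rot_ne hcub d)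
  · exact absurd h (M.rot_ne hcub _)

open Classical in
theorem sum_darts {R : Type*} [AddCommMonoid R] (g : G.Dart → R) (d : G.Dart) :
    ∑ e : G.Dart with e.fst = d.fst, g e = g d + g (M.rot d) + g (M.rot (M.rot d)) := by
  have h : (Finset.univ.filter fun e : G.Dart => e.fst = d.fst) =
      {d, M.rot d, M.rot (M.rot d)} := by
    rw [← Finset.coe_inj]
    simpa using M.darts_eq hcub d
  rw [h, Finset.sum_insert, Finset.sum_pair (M.rot_ne hcub _).symm, add_assoc]
  simp [(M.rot_ne hcub d).symm, (M.rot_rot_ne hcub d).symm]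

variable [Fintype V] [Fintype G.edgeSet] (hG : Biconnected G)

include hG

theorem face_symm_ne (d : G.Dart) : M.face d.symm ≠ M.face d := by
  classical
  intro h
  have : Nonempty G.Dart := ⟨d⟩
  -- The edge of `d` and the walk `p` close up to a cycle that passes this edge once. It is a
  -- coboundary of some `x`, which must differ on the two sides of the edge.
  obtain ⟨p, hp⟩ := exists_walk_notMem_edges hcub hG d
  obtain ⟨x, hx⟩ := M.exists_coboundary_eq hG.1 (y := Pi.single d.toEdge 1 + p.chain) (by
    rw [chainBoundary_add, chainBoundary_single, chainBoundary_chain,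
      add_comm (Pi.single d.snd 1)]
    exact funext fun w => CharTwo.add_self_eq_zero
      ((Pi.single d.fst 1 + Pi.single d.snd 1 : V → ZMod 2) w))
  have := congrFun hx d.toEdge
  rw [coboundary_toEdge, h, CharTwo.add_self_eq_zero, Pi.add_apply, Pi.single_eq_same,
    Walk.chain_of_notMem hp] at this
  simp at this

/-- Any two of the three darts at `v` are consecutive, so their faces are the two sides of an edge.
Hence a sum over the set of faces at `v` is a sum over darts. -/
theorem face_injOn (v : V) : Set.InjOn M.face {d | d.fst = v} := by
  have key : ∀ d, M.face (M.rot d) ≠ M.face d := fun d => by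
    rw [face_rot]; exact M.face_symm_ne hcub hG d
  intro d hd e he h
  rcases M.eq_or_eq_rot hcub (d := d) (e := e) (he.trans hd.symm) with rfl | rfl | rfl
  · rfl
  · exact absurd h.symm (key d)
  · have := key (M.rot (M.rot d))
    rw [M.rot_rot_rot hcub] at this
    exact absurd h this

open Classical in
theorem sum_faces_at {R : Type*} [AddCommMonoid R] (c : M.Face → R) (v : V) :
    ∑ f with v ∈ M.faceVerts f, c f = ∑ d : G.Dart with d.fst = v, c (M.face d) := by
  have h : (Finset.univ.filter fun f => v ∈ M.faceVerts f) =
      (Finset.univ.filter fun d : G.Dart => d.fst = v).image M.face := by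
    ext f
    rw [Finset.mem_image, Finset.mem_filter_univ]
    exact exists_congr fun d => and_congr_left' (by simp)
  rw [h, Finset.sum_image]
  intro d hd e he
  exact M.face_injOn hcub hG v (by simpa using hd) (by simpa using he)

open Classical in
/-- Summing the face equations with weights `c` gives every vertex the sum of the weights of
its faces. -/
theorem sum_mul_sum_faceVerts (c : M.Face → ZMod 3) (σ : V → ZMod 3) :
    ∑ f, c f * ∑ v with v ∈ M.faceVerts f, σ v =
      ∑ v, (∑ d : G.Dart with d.fst = v, c (M.face d)) * σ v := by
  simp only [← M.sum_faces_at hcub hG, Finset.mul_sum, Finset.sum_mul, Finset.sum_filter]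
  rw [Finset.sum_comm]
  refine Finset.sum_congr rfl fun v _ => Finset.sum_congr rfl fun f _ => ?_
  split_ifs <;> simp

end Cubic

end PlanarEmbedding

/-! ### The rank of the main system -/

namespace PlanarEmbedding

variable {V : Type*} {G : SimpleGraph V} (M : PlanarEmbedding G)

section Cubic

variable [Fintype G.Dart] (hcub : ∀ v, {d : G.Dart | d.fst = v}.ncard = 3)

include hcub

open Classical in
/-- On a cubic graph that is not bipartite, weights of the faces whose sum modulo three vanishes
at every vertex are constant. -/
theorem eq_of_sum_darts_eq_zero (hG : G.Connected) (hbip : ¬ G.IsBipartite)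
    {c : M.Face → ZMod 3}
    (hc : ∀ v, ∑ d : G.Dart with d.fst = v, c (M.face d) = 0) (f f' : M.Face) : c f = c f' := by
  -- Modulo three, $e-2b+a=a+b+e$: a zero sum means an arithmetic progression.
  have h3 : ∀ a b e : ZMod 3, a + b + e = 0 → e - b = b - a := by decide
  have hsq : ∀ a : ZMod 3, a ≠ 0 → a = 1 ∨ a = -1 := by decide
  set ε : G.Dart → ZMod 3 := fun d => c (M.face (M.rot d)) - c (M.face d) with hε
  have hrot : ∀ d, ε (M.rot d) = ε d := fun d =>
    h3 _ _ _ (by rw [← M.sum_darts hcub fun d => c (M.face d)]; exact hc _)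
  have hsymm : ∀ d, ε d.symm = - ε d := fun d => by
    simp only [hε, face_rot, Dart.symm_symm]; ring
  by_cases h0 : ∀ d, ε d = 0
  · refine M.apply_face_eq_of_connected hG (fun d => ?_) f f'
    rw [← face_rot]
    exact (sub_eq_zero.mp (h0 d)).symm
  · exfalso
    push Not at h0
    obtain ⟨d₀, hd₀⟩ := h0
    -- The square of `ε` is invariant under rotation and reversal, hence constant.
    have hne : ∀ d, ε d ≠ 0 := fun d h => by
      have := M.apply_eq_of_connected hG (g := fun d => ε d ^ 2) (fun d => by simp only [hrot])
        (fun d => by simp only [hsymm, neg_sq]) d₀ d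
      simp only [h] at this
      exact hd₀ (by simpa using this)
    choose dart hdart using exists_fst_eq hcub
    refine hbip ((Coloring.mk (fun v => decide (ε (dart v) = 1)) ?_ : G.Coloring Bool).colorable)
    intro v w h
    have h1 : ε (dart v) = ε (Dart.mk (v, w) h) := M.apply_eq_of_fst_eq hrot (hdart v)
    have h2 : ε (dart w) = ε (Dart.mk (v, w) h).symm := M.apply_eq_of_fst_eq hrot (hdart w)
    rw [h1, h2, hsymm]
    rcases hsq _ (hne (Dart.mk (v, w) h)) with h | h <;> rw [h] <;> decide

variable [Fintype V] [Fintype G.edgeSet] (hG : Biconnected G)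

include hG

/-- A solution of the main system satisfies the equation of the external face as well. -/
theorem isMainSolution_iff (o : M.Face) (σ : V → ZMod 3) :
    M.IsMainSolution o σ ↔ ∀ f, M.IsProper σ f := by
  classical
  have hmain : M.IsMainSolution o σ ↔ ∀ f, f ≠ o → M.IsProper σ f := by
    rw [IsMainSolution, funext_iff, Subtype.forall]
    refine forall₂_congr fun f hf => ?_
    simp only [mainMatrix, Matrix.mulVec, dotProduct, Matrix.of_apply, ite_mul, one_mul, zero_mul,
      ← Finset.sum_filter, IsProper, Pi.zero_apply]
  rw [hmain]
  refine ⟨fun h f => ?_, fun h f _ => h f⟩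
  by_cases hf : f = o
  · subst hf
    -- With all weights one every vertex gets coefficient $3=0$, so the face sums add up to zero.
    have key := M.sum_mul_sum_faceVerts hcub hG (fun _ => 1) σ
    rw [Finset.sum_eq_single f (fun g _ hg => by
      have := h g hg
      rw [IsProper] at this
      rw [one_mul]
      convert this) (by simp), one_mul] at key
    rw [IsProper]
    convert key
    symm
    refine Finset.sum_eq_zero fun v _ => ?_
    obtain ⟨d, rfl⟩ := exists_fst_eq hcub v
    rw [M.sum_darts hcub]
    have : (1 + 1 + 1 : ZMod 3) = 0 := by decide
    rw [this, zero_mul]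
  · exact h f hf

/-- The equations of the internal faces are linearly independent. -/
theorem mainMatrix_rank_add_one (hbip : ¬ G.IsBipartite) (o : M.Face) :
    (M.mainMatrix o).rank + 1 = Fintype.card M.Face := by
  classical
  have hli : LinearIndependent (ZMod 3) (M.mainMatrix o).row := by
    rw [← Matrix.vecMul_injective_iff]
    refine (injective_iff_map_eq_zero (Matrix.vecMulLinear (M.mainMatrix o))).mpr ?_
    intro w hw
    -- A relation between the rows, extended by zero to the external face, is a weight with zero
    -- vertex sums. It is constant, and its value at `o` is zero.
    set c : M.Face → ZMod 3 := fun f => if h : f ≠ o then w ⟨f, h⟩ else 0 with hcdef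
    have hc : ∀ v, ∑ d : G.Dart with d.fst = v, c (M.face d) = 0 := by
      intro v
      have := congrFun hw v
      rw [← M.sum_faces_at hcub hG c v, Finset.sum_filter,
        Fintype.sum_eq_add_sum_subtype_ne _ o]
      simp only [Matrix.vecMulLinear_apply, Matrix.vecMul, dotProduct, mainMatrix,
        Matrix.of_apply, mul_ite, mul_one, mul_zero] at this
      simp only [hcdef, ne_eq, not_true_eq_false, dite_false, ite_self, zero_add]
      rw [Pi.zero_apply] at this
      refine Eq.trans ?_ this
      exact Finset.sum_congr rfl fun f _ => by rw [dif_pos f.2]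
    ext f
    have := M.eq_of_sum_darts_eq_zero hcub hG.1 hbip hc f.1 o
    simpa [hcdef, f.2] using this
  rw [hli.rank_matrix, Fintype.card_subtype_compl, Fintype.card_subtype_eq]
  have : 0 < Fintype.card M.Face := Fintype.card_pos_iff.mpr ⟨o⟩
  omega

end Cubic

end PlanarEmbedding

/-! ### Free variables of a homogeneous system over a field -/

section FreeVariables

variable {I J K : Type*} [Field K] (A : Matrix I J K)

theorem Matrix.exists_linearIndepOn_col_compl :
    ∃ S : Set J, LinearIndepOn K A.col Sᶜ ∧
      Submodule.span K (A.col '' Sᶜ) = Submodule.span K (Set.range A.col) := by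
  obtain ⟨b, -, -, hb, hli⟩ := exists_linearIndepOn_extension (v := A.col)
    (linearIndepOn_empty K _) (Set.subset_univ ∅)
  refine ⟨bᶜ, by rwa [compl_compl], ?_⟩
  rw [compl_compl]
  refine le_antisymm (Submodule.span_mono (Set.image_subset_range _ _)) ?_
  rw [Submodule.span_le, ← Set.image_univ]
  exact hb

variable [Fintype J]

theorem Matrix.ncard_compl_eq_rank {S : Set J} (hli : LinearIndepOn K A.col Sᶜ)
    (hspan : Submodule.span K (A.col '' Sᶜ) = Submodule.span K (Set.range A.col)) :
    Sᶜ.ncard = A.rank := by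
  classical
  rw [A.rank_eq_finrank_span_cols, ← hspan, Set.image_eq_range,
    finrank_span_eq_card (b := fun x : ↥Sᶜ => A.col x) hli, ← Nat.card_coe_set_eq,
    Nat.card_eq_fintype_card]

/-- The restriction of the solutions of a homogeneous system to a set of variables. -/
def Matrix.restrictKer (S : Set J) : LinearMap.ker A.mulVecLin →ₗ[K] (S → K) :=
  (LinearMap.funLeft K K Subtype.val).comp (LinearMap.ker A.mulVecLin).subtype

theorem Matrix.finrank_ker_add_rank :
    A.rank + Module.finrank K (LinearMap.ker A.mulVecLin) = Fintype.card J := by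
  rw [← Module.finrank_pi (R := K), ← LinearMap.finrank_range_add_finrank_ker A.mulVecLin]
  rfl

/-- A solution that vanishes on `S` is a linear relation between the independent columns outside
`S`. -/
theorem Matrix.restrictKer_injective {S : Set J} (hli : LinearIndepOn K A.col Sᶜ) :
    Function.Injective (A.restrictKer S) := by
  classical
  refine (injective_iff_map_eq_zero _).mpr ?_
  rintro ⟨σ, hσ⟩ h
  have h0 : ∀ v ∈ S, σ v = 0 := fun v hv => congrFun h ⟨v, hv⟩
  have hsum : ∑ v ∈ Finset.univ.filter (· ∈ Sᶜ), σ v • A.col v = 0 := by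
    rw [Finset.sum_filter_of_ne (p := (· ∈ Sᶜ)) fun v _ hv (hvS : v ∈ S) =>
      hv (by rw [h0 v hvS, zero_smul])]
    rw [LinearMap.mem_ker, Matrix.mulVecLin_apply] at hσ
    ext i
    have := congrFun hσ i
    simpa [Matrix.mulVec, dotProduct, Matrix.col, mul_comm] using this
  have := linearIndepOn_iff'.mp hli _ σ (by intro v; simp) hsum
  ext v
  by_cases hv : v ∈ S
  · exact h0 v hv
  · exact this v (by simpa using hv)

theorem Matrix.restrictKer_bijective {S : Set J} (hli : LinearIndepOn K A.col Sᶜ)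
    (hspan : Submodule.span K (A.col '' Sᶜ) = Submodule.span K (Set.range A.col)) :
    Function.Bijective (A.restrictKer S) := by
  classical
  have hinj := A.restrictKer_injective hli
  refine ⟨hinj, (LinearMap.injective_iff_surjective_of_finrank_eq_finrank ?_).mp hinj⟩
  have h1 := A.finrank_ker_add_rank
  have h2 := A.ncard_compl_eq_rank hli hspan
  have h3 := Set.ncard_add_ncard_compl S
  rw [Module.finrank_pi, ← Nat.card_eq_fintype_card, Nat.card_coe_set_eq]
  rw [Nat.card_eq_fintype_card] at h3
  omega

/-- If there are more variables in `S` than the dimension of the solution space, then the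
solutions satisfy a nontrivial linear relation between these variables. -/
theorem Matrix.exists_relation_of_finrank_ker_lt {S : Set J}
    (hS : Module.finrank K (LinearMap.ker A.mulVecLin) < S.ncard) :
    ∃ a : J → K, (∀ v ∉ S, a v = 0) ∧ (∃ v, a v ≠ 0) ∧
      ∀ σ, A.mulVec σ = 0 → ∑ v, a v * σ v = 0 := by
  classical
  have hlt : LinearMap.range (A.restrictKer S) < ⊤ := by
    refine lt_top_iff_ne_top.mpr fun h => ?_
    have h1 := LinearMap.finrank_range_le (A.restrictKer S)
    rw [h, finrank_top, Module.finrank_pi, ← Nat.card_eq_fintype_card, Nat.card_coe_set_eq] at h1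
    omega
  -- The restrictions to `S` form a proper subspace; the coefficients of a functional that kills it
  -- are the relation.
  obtain ⟨φ, hφ, hle⟩ := Submodule.exists_le_ker_of_lt_top _ hlt
  have hsum : ∀ x : S → K, φ x = ∑ s, φ (Pi.single s 1) * x s := fun x => by
    conv_lhs => rw [pi_eq_sum_univ' x]
    simp [mul_comm]
  refine ⟨fun v => if h : v ∈ S then φ (Pi.single ⟨v, h⟩ 1) else 0, fun v hv => dif_neg hv, ?_, ?_⟩
  · by_contra! h
    refine hφ (LinearMap.ext fun x => ?_)
    rw [hsum]
    refine Finset.sum_eq_zero fun s _ => ?_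
    have := h s.1
    rw [dif_pos s.2] at this
    rw [this, zero_mul]
  · intro σ hσ
    have := hle ⟨⟨σ, hσ⟩, rfl⟩
    rw [LinearMap.mem_ker, hsum] at this
    refine Eq.trans ?_ this
    rw [← Finset.sum_subset (Finset.subset_univ (Finset.univ.filter (· ∈ S))),
      Finset.sum_subtype (p := (· ∈ S)) _ (by simp)]
    · exact Finset.sum_congr rfl fun s _ => by simp only [dif_pos s.2]; rfl
    · intro v _ hv
      have hv' : v ∉ S := by simpa using hv
      simp only [dif_neg hv', zero_mul]

end FreeVariables

/-! ### Relations, defining sets and the number of faces -/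

namespace PlanarEmbedding

variable {V : Type*} {G : SimpleGraph V} (M : PlanarEmbedding G)

/-- A set that supports a nontrivial linear relation between the spins is not a minimal defining
set. -/
theorem not_isMinimalDefining_of_relation [Fintype V] {S : Set V} {a : V → ZMod 3}
    (haS : ∀ v ∉ S, a v = 0) (ha : ∃ v, a v ≠ 0)
    (hrel : ∀ σ, (∀ f, M.IsProper σ f) → ∑ v, a v * σ v = 0) : ¬ M.IsMinimalDefining S := by
  classical
  rintro ⟨hS, hmin⟩
  obtain ⟨v, hv⟩ := ha
  refine hmin v (by_contra fun h => hv (haS v h)) fun σ τ hσ hτ h => hS σ τ hσ hτ fun w hw => ?_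
  by_cases hwv : w = v
  · subst hwv
    -- In the difference of the two relations only the term of `w` can survive, so agreement off `w`
    -- forces agreement at `w`.
    have h1 := (hrel σ hσ.2).trans (hrel τ hτ.2).symm
    rw [← sub_eq_zero, ← Finset.sum_sub_distrib, Finset.sum_eq_single w, ← mul_sub] at h1
    · exact sub_eq_zero.mp ((mul_eq_zero.mp h1).resolve_left hv)
    · intro u _ huw
      by_cases hu : u ∈ S
      · rw [h u ⟨hu, huw⟩, sub_self]
      · rw [haS u hu, zero_mul, zero_mul, sub_self]
    · simp
  · exact h w ⟨hw, hwv⟩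

theorem isDefining_of_isFreeSet [Fintype V] [Fintype G.Dart] [Fintype G.edgeSet]
    (hcub : ∀ v, {d : G.Dart | d.fst = v}.ncard = 3) (hG : Biconnected G) {o : M.Face} {S : Set V}
    (hS : M.IsFreeSet o S) : M.IsDefining S := by
  intro σ τ hσ hτ h
  have hinj := (M.mainMatrix o).restrictKer_injective hS.1
  have := @hinj ⟨σ, (M.isMainSolution_iff hcub hG o σ).mpr hσ.2⟩
    ⟨τ, (M.isMainSolution_iff hcub hG o τ).mpr hτ.2⟩ (funext fun v => h v v.2)
  exact congrArg Subtype.val this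

/-- Cubicity gives $3n$ edges; Euler's formula does the rest. -/
theorem card_face [Fintype V] [DecidableRel G.Adj] [Finite G.Dart] (hcubic : G.IsRegularOfDegree 3)
    {n : ℕ} (hn : Fintype.card V = 2 * n) [Fintype M.Face] : Fintype.card M.Face = n + 2 := by
  classical
  have h1 := G.sum_degrees_eq_twice_card_edges
  simp only [hcubic.degree_eq, Finset.sum_const, Finset.card_univ, hn, smul_eq_mul] at h1
  have h2 := M.euler
  rw [Nat.card_eq_fintype_card (α := V), hn, Nat.card_eq_fintype_card (α := G.edgeSet),
    ← edgeFinset_card] at h2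
  change 2 * n + Nat.card M.Face = _ at h2
  rw [Nat.card_eq_fintype_card] at h2
  omega

end PlanarEmbedding

/-! ### The two sides of a cycle (Jordan's theorem) -/

namespace PlanarEmbedding

variable {V : Type*} {G : SimpleGraph V} (M : PlanarEmbedding G)

section Inside

variable {o : M.Face} {u : V} {c : G.Walk u u}

theorem not_isInside_external : ¬ M.IsInside o c o := not_not.mpr .refl

theorem isInside_face_symm_iff {d : G.Dart} (h : d.edge ∉ c.edges) :
    M.IsInside o c (M.face d.symm) ↔ M.IsInside o c (M.face d) := by
  refine not_congr ⟨fun h' => h'.tail ⟨d.symm, by rwa [Dart.edge_symm], rfl, by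
    rw [Dart.symm_symm]⟩, fun h' => h'.tail ⟨d, h, rfl, rfl⟩⟩

variable [Fintype G.Dart] (hcub : ∀ v, {d : G.Dart | d.fst = v}.ncard = 3) (hc : c.IsCycle)

include M hcub hc

/-- At a vertex of a cycle of a cubic graph, exactly one dart is not on the cycle. -/
theorem exists_dart_notMem_edges {v : V} (hv : v ∈ c.support) :
    ∃ d : G.Dart, d.fst = v ∧ d.edge ∉ c.edges ∧ (M.rot d).edge ∈ c.edges ∧
      (M.rot (M.rot d)).edge ∈ c.edges := by
  set T : Set G.Dart := {d | d.fst = v ∧ d.edge ∈ c.edges} with hT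
  have hcard : T.ncard = 2 := by
    rw [← hc.ncard_neighborSet_toSubgraph_eq_two hv]
    rw [← Set.InjOn.ncard_image (s := T) (f := fun d : G.Dart => d.snd)]
    · congr 1
      ext w
      simp only [Set.mem_image, Subgraph.mem_neighborSet, Walk.adj_toSubgraph_iff_mem_edges]
      constructor
      · rintro ⟨d, ⟨rfl, hd⟩, rfl⟩
        exact hd
      · intro h
        exact ⟨⟨(v, w), c.adj_of_mem_edges h⟩, ⟨rfl, h⟩, rfl⟩
    · intro d hd e he h
      exact Dart.ext _ _ (Prod.ext (hd.1.trans he.1.symm) h)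
  obtain ⟨d, hdv, hdT⟩ : ∃ d : G.Dart, d.fst = v ∧ d ∉ T := by
    by_contra! h
    have := Set.ncard_le_ncard (s := {d : G.Dart | d.fst = v}) (t := T) h
    rw [hcub] at this
    omega
  have hd : d.edge ∉ c.edges := fun h => hdT ⟨hdv, h⟩
  have hcases : ∀ e ∈ T, e = M.rot d ∨ e = M.rot (M.rot d) := fun e he =>
    (M.eq_or_eq_rot hcub (he.1.trans hdv.symm)).resolve_left fun h => hdT (h ▸ he)
  have hsub : ∀ e₀ : G.Dart, ∃ e ∈ T, e ≠ e₀ := fun e₀ =>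
    Set.exists_ne_of_one_lt_ncard (by omega) e₀
  refine ⟨d, hdv, hd, ?_, ?_⟩
  · obtain ⟨e, he, hne⟩ := hsub (M.rot (M.rot d))
    obtain rfl := (hcases e he).resolve_right hne
    exact he.2
  · obtain ⟨e, he, hne⟩ := hsub (M.rot d)
    obtain rfl := (hcases e he).resolve_left hne
    exact he.2

variable [Fintype G.edgeSet]

/-- A chain without boundary that is supported on a cycle is constant on the cycle. -/
theorem chain_eq_of_mem_edges {y : G.edgeSet → ZMod 2} (hy : chainBoundary y = 0)
    (hyc : ∀ e, e.1 ∉ c.edges → y e = 0) {e e' : G.edgeSet} (he : e.1 ∈ c.edges)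
    (he' : e'.1 ∈ c.edges) : y e = y e' := by
  classical
  -- At a vertex of the cycle the third edge contributes zero, so zero boundary equates the values
  -- at the two cycle edges.
  have hloc : ∀ d d' : G.Dart, d.fst = d'.fst → d.edge ∈ c.edges → d'.edge ∈ c.edges →
      y d.toEdge = y d'.toEdge := by
    intro d d' h hd hd'
    obtain ⟨e, hev, hec, -, -⟩ := M.exists_dart_notMem_edges hcub hc
      (c.fst_mem_support_of_mem_edges hd)
    have hsum := congrFun hy e.fst
    rw [chainBoundary_apply, M.sum_darts hcub, hyc e.toEdge hec, zero_add, Pi.zero_apply,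
      CharTwo.add_eq_zero] at hsum
    rcases (M.eq_or_eq_rot hcub hev.symm).resolve_left (fun h => hec (h ▸ hd)) with h1 | h1 <;>
      rcases (M.eq_or_eq_rot hcub (h.symm.trans hev.symm)).resolve_left
        (fun h => hec (h ▸ hd')) with h2 | h2 <;> rw [h1, h2] <;> first | rfl | rw [hsum]
  have hwalk : ∀ {a b : V} (p : G.Walk a b), (∀ e ∈ p.edges, e ∈ c.edges) → ∀ d : G.Dart,
      d.fst = a → d.edge ∈ c.edges → ∀ e : G.edgeSet, e.1 ∈ p.edges → y e = y d.toEdge := by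
    intro a b p
    induction p with
    | nil => intro _ d _ _ e he; simp at he
    | @cons a b w h p ih =>
      intro hp d hda hd e he
      rw [Walk.edges_cons] at hp he
      have h0 : (Dart.mk (a, b) h).edge ∈ c.edges := hp _ List.mem_cons_self
      rw [hloc d (Dart.mk (a, b) h) hda hd h0]
      rcases List.mem_cons.mp he with he | he
      · congr 1
        exact Subtype.ext he
      · rw [← Dart.toEdge_symm]
        refine ih (fun e he => hp e (List.mem_cons_of_mem _ he)) _ rfl ?_ e he
        rwa [Dart.edge_symm]
  obtain ⟨d, hd, hdc⟩ : ∃ d : G.Dart, d.fst = u ∧ d.edge ∈ c.edges := by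
    obtain ⟨e, hev, -, he, -⟩ := M.exists_dart_notMem_edges hcub hc c.start_mem_support
    exact ⟨_, (M.rot_fst e).trans hev, he⟩
  rw [hwalk c (fun _ h => h) d hd hdc e he, hwalk c (fun _ h => h) d hd hdc e' he']

/-- Crossing an edge of a cycle leads from one side of it to the other. -/
theorem isInside_face_symm_iff_not [Fintype V] (hG : G.Connected) {d : G.Dart}
    (hd : d.edge ∈ c.edges) :
    M.IsInside o c (M.face d.symm) ↔ ¬ M.IsInside o c (M.face d) := by
  classical
  have : Nonempty G.Dart := ⟨d⟩
  set χ : M.Face → ZMod 2 := fun f => if M.IsInside o c f then 1 else 0 with hχ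
  have hχc : ∀ e : G.edgeSet, e.1 ∉ c.edges → M.coboundary χ e = 0 := by
    intro e he
    obtain ⟨d, rfl⟩ := exists_toEdge_eq e
    rw [coboundary_toEdge, CharTwo.add_eq_zero]
    simp only [hχ, M.isInside_face_symm_iff he]
  have hconst := fun e : G.edgeSet => M.chain_eq_of_mem_edges hcub hc
    (M.chainBoundary_coboundary χ) hχc (e := e) (e' := d.toEdge)
  by_cases h0 : M.coboundary χ d.toEdge = 0
  · exfalso
    -- If the indicator `χ` does not jump at `d`, it jumps nowhere and there is no inside. Then
    -- every face is reached from `o` without crossing `c`, so a function with coboundary `c.chain`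
    -- is constant, contradicting that this chain is 1 at `d`.
    have hout : ∀ f, ¬ M.IsInside o c f := by
      intro f hf
      have h1 : χ f = χ o := M.apply_face_eq_of_connected hG (fun d' => by
        by_cases h : d'.edge ∈ c.edges
        · have := hconst d'.toEdge h hd
          rwa [h0, coboundary_toEdge, CharTwo.add_eq_zero] at this
        · have := hχc d'.toEdge h
          rwa [coboundary_toEdge, CharTwo.add_eq_zero] at this) f o
      simp [hχ, hf, M.not_isInside_external] at h1
    obtain ⟨x, hx⟩ := M.exists_coboundary_eq hG (y := c.chain) (by
      rw [chainBoundary_chain]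
      exact funext fun w => CharTwo.add_self_eq_zero ((Pi.single u 1 : V → ZMod 2) w))
    have hxo : ∀ f, x f = x o := by
      intro f
      have := not_not.mp (hout f)
      induction this with
      | refl => rfl
      | tail _ h ih =>
        obtain ⟨d', hd', rfl, rfl⟩ := h
        have := congrFun hx d'.toEdge
        rw [coboundary_toEdge, Walk.chain_of_notMem hd', CharTwo.add_eq_zero] at this
        rw [← this, ih]
    have := congrFun hx d.toEdge
    rw [coboundary_toEdge, hxo, hxo (M.face d.symm), CharTwo.add_self_eq_zero,
      Walk.chain_of_mem hc.edges_nodup hd] at this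
    exact zero_ne_one this
  · rw [coboundary_toEdge] at h0
    simp only [hχ] at h0
    by_cases h1 : M.IsInside o c (M.face d) <;> by_cases h2 : M.IsInside o c (M.face d.symm) <;>
      simp [h1, h2] at h0 ⊢
    exact h0 (by decide)

end Inside

end PlanarEmbedding

/-! ### Zebras -/

theorem SimpleGraph.Walk.exists_dart_at_start {V : Type*} {G : SimpleGraph V} {u v : V}
    (p : G.Walk u v) (h : u ≠ v) : ∃ d : G.Dart, d.fst = u ∧ d.edge ∈ p.edges := by
  cases p with
  | nil => exact absurd rfl h
  | cons h p => exact ⟨⟨(_, _), h⟩, rfl, List.mem_cons_self⟩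

namespace PlanarEmbedding

variable {V : Type*} {G : SimpleGraph V} (M : PlanarEmbedding G)

/-- An even set of vertices of a closed walk is the boundary of a chain of edges of the walk. -/
theorem exists_chain_on_walk [Fintype V] [Fintype G.Dart] [Fintype G.edgeSet] {u : V}
    (c : G.Walk u u) {W : Finset V} (hW : ∀ w ∈ W, w ∈ c.support) (heven : Even W.card) :
    ∃ y : G.edgeSet → ZMod 2, (∀ e, e.1 ∉ c.edges → y e = 0) ∧
      ∀ v, chainBoundary y v = open Classical in if v ∈ W then 1 else 0 := by
  classical
  -- Add the arcs from the base point `u` to the points of `W`; the contributions at `u` cancel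
  -- since their number is even.
  refine ⟨∑ w ∈ W.attach, (c.takeUntil w.1 (hW w.1 w.2)).chain, fun e he => ?_, fun v => ?_⟩
  · rw [Finset.sum_apply]
    exact Finset.sum_eq_zero fun w _ => Walk.chain_of_notMem fun h =>
      he (c.edges_takeUntil_subset_edges _ h)
  · rw [chainBoundary_sum]
    simp only [chainBoundary_chain, Finset.sum_add_distrib, Finset.sum_const, Finset.card_attach]
    have h2 : (W.card : ZMod 2) = 0 := (ZMod.natCast_eq_zero_iff_even).mpr heven
    rw [Finset.sum_attach W (fun w => (Pi.single w 1 : V → ZMod 2)), Pi.add_apply, Pi.smul_apply,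
      nsmul_eq_mul, h2, zero_mul, zero_add, Finset.sum_apply]
    simp [Pi.single_apply]

namespace ZebraData

variable {M} {o : M.Face} (Z : M.ZebraData o)

/-- Disjoint paths with distinct ends have $2m$ distinct endpoints. Since $|W|=2m$, they exhaust
`W`. -/
theorem endpoint_injective : Function.Injective (Sum.elim Z.src Z.tgt) := by
  have hdisj : ∀ i j, ∀ v ∈ (Z.path i).support, v ∈ (Z.path j).support → i = j :=
    fun i j v hi hj => by_contra fun h => Z.path_disjoint i j h v hi hj
  rintro (i | i) (j | j) h <;> simp only [Sum.elim_inl, Sum.elim_inr] at h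
  · rw [hdisj i j _ (Z.path i).start_mem_support (by rw [h]; exact (Z.path j).start_mem_support)]
  · obtain rfl := hdisj i j _ (Z.path i).start_mem_support (by
      rw [h]; exact (Z.path j).end_mem_support)
    exact absurd h (Z.src_ne_tgt i)
  · obtain rfl := hdisj i j _ (Z.path i).end_mem_support (by
      rw [h]; exact (Z.path j).start_mem_support)
    exact absurd h.symm (Z.src_ne_tgt i)
  · rw [hdisj i j _ (Z.path i).end_mem_support (by rw [h]; exact (Z.path j).end_mem_support)]

theorem range_endpoint [Finite V] : Set.range (Sum.elim Z.src Z.tgt) = Z.W := by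
  refine Set.eq_of_subset_of_ncard_le ?_ ?_
  · rintro _ ⟨j | j, rfl⟩
    exacts [Z.src_mem j, Z.tgt_mem j]
  · rw [Z.W_card, ← Set.image_univ, Set.ncard_image_of_injective _ Z.endpoint_injective,
      Set.ncard_univ, Nat.card_eq_fintype_card, Fintype.card_sum, Fintype.card_fin, two_mul]

theorem exists_dart_of_mem_W [Finite V] {w : V} (hw : w ∈ Z.W) :
    ∃ j, ∃ e : G.Dart, e.fst = w ∧ e.edge ∈ (Z.path j).edges := by
  rw [← Z.range_endpoint] at hw
  obtain ⟨j | j, rfl⟩ := hw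
  · exact ⟨j, (Z.path j).exists_dart_at_start (Z.src_ne_tgt j)⟩
  · obtain ⟨e, he, hej⟩ := (Z.path j).reverse.exists_dart_at_start (Z.src_ne_tgt j).symm
    exact ⟨j, e, he, by rwa [Walk.edges_reverse, List.mem_reverse] at hej⟩

open Classical in
theorem sum_endpoints [Finite V] (v : V) :
    (∑ j, (Pi.single (Z.src j) 1 + Pi.single (Z.tgt j) 1 : V → ZMod 2)) v =
      if v ∈ Z.W then 1 else 0 := by
  have h : (∑ j, (Pi.single (Z.src j) 1 + Pi.single (Z.tgt j) 1 : V → ZMod 2)) v =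
      ∑ s, (Pi.single (Sum.elim Z.src Z.tgt s) 1 : V → ZMod 2) v := by
    simp [Finset.sum_apply, Finset.sum_add_distrib]
  rw [h]
  by_cases hv : v ∈ Z.W
  · rw [if_pos hv]
    rw [← Z.range_endpoint] at hv
    obtain ⟨s, rfl⟩ := hv
    rw [Finset.sum_eq_single s, Pi.single_eq_same]
    · exact fun t _ hts => Pi.single_eq_of_ne (fun h => hts (Z.endpoint_injective h.symm)) _
    · simp
  · rw [if_neg hv]
    refine Finset.sum_eq_zero fun s _ => Pi.single_eq_of_ne (fun h => hv ?_) _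
    rw [← Z.range_endpoint, h]
    exact ⟨s, rfl⟩

/-- The faces inside `C₀` and outside `C₁, …, C_k`. -/
def Between (f : M.Face) : Prop :=
  M.IsInside o (Z.cycle 0) f ∧ ∀ i, i ≠ 0 → ¬ M.IsInside o (Z.cycle i) f

theorem between_face_symm_iff {d : G.Dart} (h : ∀ i, d.edge ∉ (Z.cycle i).edges) :
    Z.Between (M.face d.symm) ↔ Z.Between (M.face d) := by
  simp only [Between, M.isInside_face_symm_iff (h _)]

/-- No edge of $C_0$ meets such a vertex, so its three faces lie on the same side of $C_0$. -/
theorem isInside_cycle_zero_of_fst [Fintype G.Dart]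
    (hcub : ∀ v, {d : G.Dart | d.fst = v}.ncard = 3) {d : G.Dart}
    (hd : d.fst ∈ M.innerVerts o (Z.cycle 0)) :
    M.IsInside o (Z.cycle 0) (M.face d) := by
  obtain ⟨⟨f, hf, e, he, rfl⟩, hsupp⟩ := hd
  have hnot : ∀ d' : G.Dart, d'.fst = d.fst → d'.edge ∉ (Z.cycle 0).edges := fun d' h h' =>
    hsupp (h ▸ Walk.fst_mem_support_of_mem_edges _ h')
  have hstep : ∀ d' : G.Dart, d'.fst = d.fst → M.IsInside o (Z.cycle 0) (M.face d') →
      M.IsInside o (Z.cycle 0) (M.face (M.rot d')) := fun d' h h' => by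
    rwa [M.face_rot, M.isInside_face_symm_iff (hnot d' h)]
  rcases M.eq_or_eq_rot hcub he.symm with h | h | h <;> rw [h]
  · exact hf
  · exact hstep e he hf
  · exact hstep _ ((M.rot_fst e).trans he) (hstep e he hf)

variable [Fintype V] [Fintype G.Dart] [Fintype G.edgeSet]

/-- The paths cut the region between the cycles into pieces that can be coloured with two colours
such that the colour changes exactly along the paths. -/
theorem exists_colouring (hG : G.Connected) [Nonempty G.Dart] : ∃ x : M.Face → ZMod 2,
    ∀ d : G.Dart, (∀ i, d.edge ∉ (Z.cycle i).edges) →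
      (x (M.face d) ≠ x (M.face d.symm) ↔ ∃ j, d.edge ∈ (Z.path j).edges) := by
  classical
  have hT := fun i => exists_chain_on_walk (Z.cycle i)
    (W := Finset.univ.filter (· ∈ Z.W ∩ {v | v ∈ (Z.cycle i).support})) (fun w hw => by
      rw [Finset.mem_filter_univ] at hw
      exact hw.2) (by
      convert Z.W_even i
      rw [← Set.ncard_coe_finset]
      congr 1
      ext
      simp)
  choose T hT hTb using hT
  -- The paths have boundary `W`; evenness on each cycle allows closing them up by edges of the
  -- cycles, where the colouring is unconstrained.
  obtain ⟨x, hx⟩ := M.exists_coboundary_eq hG (y := ∑ j, (Z.path j).chain + ∑ i, T i) (by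
    ext v
    rw [chainBoundary_add, chainBoundary_sum, chainBoundary_sum, Pi.add_apply]
    simp only [chainBoundary_chain]
    rw [Z.sum_endpoints, Finset.sum_apply, Pi.zero_apply, CharTwo.add_eq_zero]
    by_cases hv : v ∈ Z.W
    · obtain ⟨i, hi⟩ := Z.W_subset v hv
      rw [if_pos hv, Finset.sum_eq_single i]
      · simp [hTb, hv, hi]
      · intro i' _ hne
        simp [hTb, Z.cycle_disjoint i i' hne.symm v hi]
      · simp
    · simp [hTb, hv])
  refine ⟨x, fun d hd => ?_⟩
  have hxd := congrFun hx d.toEdge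
  rw [coboundary_toEdge, Pi.add_apply, Finset.sum_apply, Finset.sum_apply,
    Finset.sum_eq_zero (s := Finset.univ) (f := fun i => T i d.toEdge) fun i _ => hT i _ (hd i),
    add_zero] at hxd
  rw [Ne, ← CharTwo.add_eq_zero, hxd]
  constructor
  · intro h
    by_contra! hno
    exact h (Finset.sum_eq_zero fun j _ => Walk.chain_of_notMem (hno j))
  · rintro ⟨j, hj⟩
    rw [Finset.sum_eq_single j, Walk.chain_of_mem (Z.isPath j).isTrail.edges_nodup hj]
    · exact one_ne_zero
    · intro j' _ hne
      refine Walk.chain_of_notMem fun h => ?_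
      exact Z.path_disjoint j j' hne.symm _ (Walk.fst_mem_support_of_mem_edges _ hj)
        (Walk.fst_mem_support_of_mem_edges _ h)
    · simp

variable (hcub : ∀ v, {d : G.Dart | d.fst = v}.ncard = 3)

include hcub

/-- The inner face at an edge of $C_0$ qualifies: its neighbour across that edge is outside $C_0$,
hence outside every $C_i$, and the edge is not on $C_i$. -/
theorem exists_between (hG : G.Connected) : ∃ f, Z.Between f := by
  classical
  have hout : ∀ i, i ≠ 0 → ∀ f, ¬ M.IsInside o (Z.cycle 0) f → ¬ M.IsInside o (Z.cycle i) f := by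
    intro i hi f hf
    refine not_not.mpr ?_
    have hf' := not_not.mp hf
    induction hf' with
    | refl => exact .refl
    | tail hg h ih =>
      obtain ⟨d, hd, rfl, rfl⟩ := h
      have hg' : ¬ M.IsInside o (Z.cycle 0) (M.face d) := not_not.mpr hg
      -- A route that stays outside $C_0$ cannot cross an edge of $C_i$, whose sides are inside
      -- $C_0$.
      refine (ih hg').tail ⟨d, fun hdi => hg' ?_, rfl, rfl⟩
      exact Z.isInside_cycle_zero_of_fst hcub
        (Z.cycle_inner i hi _ (Walk.fst_mem_support_of_mem_edges _ hdi))
  obtain ⟨d₀, hd₀, -, hd, -⟩ := M.exists_dart_notMem_edges hcub (Z.isCycle 0)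
    (Z.cycle 0).start_mem_support
  have key : ∀ d : G.Dart, d.edge ∈ (Z.cycle 0).edges → M.IsInside o (Z.cycle 0) (M.face d) →
      Z.Between (M.face d) := by
    intro d hd h
    refine ⟨h, fun i hi => ?_⟩
    have hdi : d.edge ∉ (Z.cycle i).edges := fun h' =>
      Z.cycle_disjoint i 0 hi _ (Walk.fst_mem_support_of_mem_edges _ h')
        (Walk.fst_mem_support_of_mem_edges _ hd)
    rw [← M.isInside_face_symm_iff hdi]
    refine hout i hi _ ?_
    rw [M.isInside_face_symm_iff_not hcub (Z.isCycle 0) hG hd]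
    exact not_not.mpr h
  by_cases h : M.IsInside o (Z.cycle 0) (M.face (M.rot d₀))
  · exact ⟨_, key _ hd h⟩
  · exact ⟨_, key (M.rot d₀).symm (by rwa [Dart.edge_symm])
      ((M.isInside_face_symm_iff_not hcub (Z.isCycle 0) hG hd).mpr h)⟩

/-- Weights of the faces, zero on the external one, whose sums at the vertices vanish outside the
zebra. -/
theorem exists_weights (hG : G.Connected) : open Classical in
    ∃ c : M.Face → ZMod 3, c o = 0 ∧ (∃ f, c f ≠ 0) ∧
      ∀ v ∉ Z.verts, ∑ d : G.Dart with d.fst = v, c (M.face d) = 0 := by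
  classical
  obtain ⟨f₀, hf₀⟩ := Z.exists_between hcub hG
  have : Nonempty G.Dart := ⟨(M.exists_face_eq o).choose⟩
  obtain ⟨x, hx⟩ := Z.exists_colouring hG
  refine ⟨fun f => if Z.Between f then (if x f = 0 then 1 else -1) else 0, ?_, ⟨f₀, ?_⟩, ?_⟩
  · exact if_neg fun h => M.not_isInside_external h.1
  · simp only [if_pos hf₀]
    split_ifs <;> decide
  intro v hv
  by_cases hW : v ∈ Z.W
  · obtain ⟨i, hi⟩ := Z.W_subset v hW
    obtain ⟨d, rfl, hd, hd1, hd2⟩ := M.exists_dart_notMem_edges hcub (Z.isCycle i) hi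
    obtain ⟨j, e, hev, hej⟩ := Z.exists_dart_of_mem_W hW
    have hei : ∀ i, e.edge ∉ (Z.cycle i).edges := fun i => Z.path_edges j _ hej i
    obtain rfl : e = d := by
      rcases M.eq_or_eq_rot hcub hev with rfl | rfl | rfl
      · rfl
      · exact absurd hd1 (hei i)
      · exact absurd hd2 (hei i)
    have hb1 : Z.Between (M.face e) := Z.path_between j e hej
    have hb2 : Z.Between (M.face e.symm) := Z.path_between j e.symm (by rwa [Dart.edge_symm])
    -- The third face lies across a cycle edge from a face of the region, hence outside $C_0$ or
    -- inside $C_i$. The weights at a vertex of `W` are thus $1$, $-1$ and $0$.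
    have hb3 : ¬ Z.Between (M.face (M.rot e).symm) := by
      rw [← M.face_rot] at hb2
      have hflip := M.isInside_face_symm_iff_not (o := o) hcub (Z.isCycle i) hG hd1
      intro hb3
      by_cases h0 : i = 0
      · subst h0
        exact hflip.mp hb3.1 hb2.1
      · exact hb3.2 i h0 (hflip.mpr (hb2.2 i h0))
    have hne := (hx e hei).mpr ⟨j, hej⟩
    rw [M.sum_darts hcub, M.face_rot, M.face_rot]
    beta_reduce
    rw [if_pos hb1, if_pos hb2, if_neg hb3]
    have h2 : ∀ a b : ZMod 2, a ≠ b →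
        ((if a = 0 then 1 else -1 : ZMod 3) + (if b = 0 then 1 else -1) + 0) = 0 := by decide
    exact h2 _ _ hne
  · have hno : (∀ i, v ∉ (Z.cycle i).support) ∧ ∀ j, v ∉ (Z.path j).support := by
      refine ⟨fun i h => hv ⟨.inl ⟨i, h⟩, hW⟩, fun j h => hv ⟨.inr ⟨j, h⟩, hW⟩⟩
    -- Off the cycles and paths nothing changes around the vertex: three equal weights sum to zero.
    have hsame : ∀ d : G.Dart, d.fst = v →
        (if Z.Between (M.face (M.rot d)) then (if x (M.face (M.rot d)) = 0 then 1 else -1) else 0 :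
          ZMod 3) =
        if Z.Between (M.face d) then (if x (M.face d) = 0 then 1 else -1) else 0 := by
      rintro d rfl
      have hdc : ∀ i, d.edge ∉ (Z.cycle i).edges := fun i h =>
        hno.1 i (Walk.fst_mem_support_of_mem_edges _ h)
      have hxd : x (M.face d) = x (M.face d.symm) := by
        by_contra h
        obtain ⟨j, hj⟩ := (hx d hdc).mp h
        exact hno.2 j (Walk.fst_mem_support_of_mem_edges _ hj)
      rw [M.face_rot, ← hxd]
      simp only [Z.between_face_symm_iff hdc]
    obtain ⟨d, rfl⟩ := exists_fst_eq hcub v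
    rw [M.sum_darts hcub]
    beta_reduce
    rw [hsame (M.rot d) (M.rot_fst d), hsame d rfl]
    have h3 : ∀ a : ZMod 3, a + a + a = 0 := by decide
    exact h3 _

end ZebraData

/-- No set that contains a zebra is a minimal defining set. -/
theorem not_isMinimalDefining_of_isZebra [Fintype V] [Fintype G.Dart] [Fintype G.edgeSet]
    (hcub : ∀ v, {d : G.Dart | d.fst = v}.ncard = 3) (hG : Biconnected G)
    (hbip : ¬ G.IsBipartite) {o : M.Face} {S A : Set V} (hA : M.IsZebra o A) (hAS : A ⊆ S) :
    ¬ M.IsMinimalDefining S := by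
  classical
  obtain ⟨Z, rfl⟩ := hA
  obtain ⟨c, hco, ⟨f, hf⟩, hc⟩ := Z.exists_weights hcub hG.1
  refine M.not_isMinimalDefining_of_relation
    (a := fun v => ∑ d : G.Dart with d.fst = v, c (M.face d))
    (fun v hv => by convert hc v fun h => hv (hAS h)) ?_ fun σ hσ => ?_
  -- Zero vertex sums would make `c` constant, but it vanishes at `o` and not at `f`.
  · by_contra! h
    refine hf ?_
    rw [← hco]
    exact M.eq_of_sum_darts_eq_zero hcub hG.1 hbip (fun v => by convert h v) f o
  · have := M.sum_mul_sum_faceVerts hcub hG c σ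
    refine Eq.trans ?_ (this.symm.trans ?_)
    · congr!
    · refine Finset.sum_eq_zero fun f _ => ?_
      have := hσ f
      rw [IsProper] at this
      rw [this, mul_zero]

end PlanarEmbedding

/-! ### The theorem -/

theorem theorem3 {V : Type*} [Fintype V] (G : SimpleGraph V) [DecidableRel G.Adj]
    (hcubic : G.IsRegularOfDegree 3) (hbiconn : Biconnected G) (hnonbip : ¬ G.IsBipartite)
    (n : ℕ) (hn : Fintype.card V = 2 * n) (M : PlanarEmbedding G) (o : M.Face) :
    (∃ S : Set V, M.IsFreeSet o S) ∧
    (∀ S : Set V, M.IsFreeSet o S →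
      S.ncard = n - 1 ∧ M.IsDefining S ∧
      ∀ a : S → ZMod 3, ∃ σ : V → ZMod 3,
        M.IsMainSolution o σ ∧ (∀ v : S, σ v = a v) ∧
        (∀ τ : V → ZMod 3, M.IsMainSolution o τ → (∀ v : S, τ v = a v) → τ = σ) ∧
        ((∀ v, σ v ≠ 0) → M.IsHeawood σ)) ∧
    (∀ S A : Set V, M.IsZebra o A → A ⊆ S → ¬ M.IsMinimalDefining S) ∧
    (∀ S : Set V, S.ncard = n → ¬ M.IsMinimalDefining S) := by
  classical
  have hcub := hcubic.ncard_darts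
  have hrank := M.mainMatrix_rank_add_one hcub hbiconn hnonbip o
  rw [M.card_face hcubic hn] at hrank
  refine ⟨(M.mainMatrix o).exists_linearIndepOn_col_compl, fun S hS => ⟨?_, ?_, fun a => ?_⟩,
    fun S A => M.not_isMinimalDefining_of_isZebra hcub hbiconn hnonbip, fun S hS => ?_⟩
  · have h1 := (M.mainMatrix o).ncard_compl_eq_rank hS.1 hS.2
    have h2 := Set.ncard_add_ncard_compl S
    rw [Nat.card_eq_fintype_card, hn] at h2
    omega
  · exact M.isDefining_of_isFreeSet hcub hbiconn hS
  · obtain ⟨hinj, hsurj⟩ := (M.mainMatrix o).restrictKer_bijective hS.1 hS.2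
    obtain ⟨⟨σ, hσ⟩, h⟩ := hsurj a
    refine ⟨σ, hσ, fun v => congrFun h v, fun τ hτ hτa => ?_, fun h0 =>
      ⟨h0, (M.isMainSolution_iff hcub hbiconn o σ).mp hσ⟩⟩
    have := @hinj ⟨τ, hτ⟩ ⟨σ, hσ⟩ ((funext hτa).trans h.symm)
    exact congrArg Subtype.val this
  · have hdim := (M.mainMatrix o).finrank_ker_add_rank
    -- The solution space has dimension $2n-(n+1)=n-1<|S|$.
    obtain ⟨a, haS, ha, hrel⟩ := (M.mainMatrix o).exists_relation_of_finrank_ker_lt (S := S)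
      (by omega)
    exact M.not_isMinimalDefining_of_relation haS ha fun σ hσ =>
      hrel σ ((M.isMainSolution_iff hcub hbiconn o σ).mpr hσ)
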